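/- Let $\mathbb{S}^2\subset\mathbb{R}^3$ be the unit sphere with the Euclidean metric, and let $\mathbb{C}=\coprod_{p\in\mathbb{S}^2}\mathbb{L}^2([0,1],T_p(\mathbb{S}^2))$ be the vector bundle over $\mathbb{S}^2$ with the Riemannian metric $\langle (u_1,w_1),(u_2,w_2)\rangle=u_1\cdot u_2+\int_0^1 w_1(t)\cdot w_2(t)\,dt$ on $T_{(x,v)}(\mathbb{C})\cong T_x(\mathbb{S}^2)\oplus \mathbb{L}^2([0,1],T_x(\mathbb{S}^2))$. The velocity of a smooth path $(\beta(s),q(s,\cdot))$, $s\in[0,1]$, in $\mathbb{C}$ is $(\dot\beta(s),\nabla_{\dot\beta(s)}q(s,\cdot))$, where $\nabla$ is covariant differentiation on $\mathbb{S}^2$ along $\beta$, so that its length is $\int_0^1\bigl(|\dot\beta(s)|^2+\int_0^1|\nabla_{\dot\beta(s)}q(s,t)|^2dt\bigr)^{1/2}ds$. Such a path is called a geodesic if it is a shortest one among all smooth paths in $\mathbb{C}$ with the same endpoints $(p_1,q_1)$, $(p_2,q_2)$. Given a linear isometric map $\mathcal{T}:T_{p_1}(\mathbb{S}^2)\to T_{p_2}(\mathbb{S}^2)$,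 a smooth curve $\beta:[0,1]\to\mathbb{S}^2$ from $p_1$ to $p_2$ is called $p$-optimal (for $\mathcal T$) if (1) the parallel transport map along $\beta$ from $T_{p_1}(\mathbb{S}^2)$ to $T_{p_2}(\mathbb{S}^2)$ equals $\mathcal{T}$, and (2) $\beta$ is a shortest one among all smooth curves on $\mathbb{S}^2$ from $p_1$ to $p_2$ with property (1). If a path $(\beta^*(s),q(s,\cdot))$, $s\in[0,1]$, in $\mathbb{C}$ is a geodesic, then its baseline $\beta^*$ is a $p$-optimal curve (for some linear isometric map $\mathcal{T}$ between the tangent planes at its endpoints, namely the one induced by $\beta^*$): it is a shortest curve among those from $\beta^*(0)$ to $\beta^*(1)$ that induce the same parallel transport map. -/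

import Mathlib

open MeasureTheory Set
open scoped ContDiff

noncomputable section

/-- Ambient Euclidean space `ℝ³`. -/
abbrev E3 : Type := EuclideanSpace ℝ (Fin 3)

/-- The unit sphere `𝕊²` in `ℝ³`. -/
def S2 : Set E3 := Metric.sphere 0 1

/-- The tangent plane `T_x(𝕊²) = x^⊥` at a point `x` of the sphere, with the Euclidean metric. -/
abbrev tangentPlane (x : E3) : Submodule ℝ E3 := (ℝ ∙ x)ᗮ

/-- The orthogonal projection of `ℝ³` onto `T_x(𝕊²)`. -/
def tangentProj (x : E3) : E3 →L[ℝ] E3 := (tangentPlane x).starProjection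

/-- The parameter interval `[0,1]`. -/
abbrev I01 : Set ℝ := Icc 0 1

/-- `β : [0,1] → 𝕊²` is a smooth curve from `p₁` to `p₂`; values outside `[0,1]` play no role. -/
structure IsSphereCurve (p₁ p₂ : E3) (β : ℝ → E3) : Prop where
  smooth : ContDiffOn ℝ ∞ β I01
  mem_sphere : ∀ s ∈ I01, β s ∈ S2
  source : β 0 = p₁
  target : β 1 = p₂

/-- The velocity at `s ∈ [0,1]` (one-sided at the endpoints). -/
def velocity {F : Type*} [NormedAddCommGroup F] [NormedSpace ℝ F] (c : ℝ → F) (s : ℝ) : F :=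
  derivWithin c I01 s

/-- The length of a curve on the sphere. -/
def curveLength (β : ℝ → E3) : ℝ := ∫ s in (0 : ℝ)..1, ‖velocity β s‖

/-- `V` is a smooth tangent vector field along `β` that is parallel for the Levi-Civita connection
of the sphere, i.e. the tangential part of its derivative vanishes. -/
structure IsParallelAlong (β V : ℝ → E3) : Prop where
  smooth : ContDiffOn ℝ ∞ V I01
  tangent : ∀ s ∈ I01, V s ∈ tangentPlane (β s)
  parallel : ∀ s ∈ I01, tangentProj (β s) (velocity V s) = 0

/-- The parallel transport along `β` (a curve from `p₁` to `p₂`) is the map `T`. -/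
def InducesTransport {p₁ p₂ : E3} (β : ℝ → E3)
    (T : tangentPlane p₁ →ₗᵢ[ℝ] tangentPlane p₂) : Prop :=
  ∀ v : tangentPlane p₁, ∃ V : ℝ → E3, IsParallelAlong β V ∧ V 0 = v ∧ V 1 = T v

/-- `β` is `p`-optimal for the linear isometry `T : T_{p₁}(𝕊²) → T_{p₂}(𝕊²)`: it is a curve from
`p₁` to `p₂` whose parallel transport is `T`, and it is the shortest amongst all such curves. -/
structure IsPOptimalFor {p₁ p₂ : E3} (T : tangentPlane p₁ →ₗᵢ[ℝ] tangentPlane p₂)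
    (β : ℝ → E3) : Prop where
  curve : IsSphereCurve p₁ p₂ β
  transport : InducesTransport β T
  shortest : ∀ γ : ℝ → E3, IsSphereCurve p₁ p₂ γ → InducesTransport γ T →
    curveLength β ≤ curveLength γ

/-- `β` is a `p`-optimal curve: it is `p`-optimal for some linear isometry between the tangent
planes at its endpoints (necessarily the one induced by `β`). -/
def IsPOptimal (β : ℝ → E3) : Prop :=
  ∃ T : tangentPlane (β 0) →ₗᵢ[ℝ] tangentPlane (β 1), IsPOptimalFor T β

/-- The Hilbert space `L²([0,1], ℝ³)`. -/
abbrev L2E3 : Type := Lp E3 2 ((volume : Measure ℝ).restrict I01)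

/-- The vector bundle `ℂ = ∐_{x ∈ 𝕊²} L²([0,1], T_x(𝕊²))`, as a subset of
`ℝ³ × L²([0,1], ℝ³)`. -/
def trajBundle : Set (E3 × L2E3) :=
  {z | z.1 ∈ S2 ∧ ∀ᵐ t ∂((volume : Measure ℝ).restrict I01), z.2 t ∈ tangentPlane z.1}

/-- `s ↦ (β s, q s)`, `s ∈ [0,1]`, is a smooth path in the bundle. -/
structure IsBundlePath (β : ℝ → E3) (q : ℝ → L2E3) : Prop where
  smooth_base : ContDiffOn ℝ ∞ β I01
  smooth_fibre : ContDiffOn ℝ ∞ q I01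
  mem_bundle : ∀ s ∈ I01, (β s, q s) ∈ trajBundle

/-- The covariant derivative `∇_{β_s} q (s, ·)` along `β`: for each `t`, the tangential part of
the `s`-derivative. -/
def covDeriv (β : ℝ → E3) (q : ℝ → L2E3) (s : ℝ) : L2E3 :=
  (tangentProj (β s)).compLp (velocity q s)

/-- The length of a path in the bundle for the Riemannian metric
`⟨(u₁, w₁), (u₂, w₂)⟩ = u₁ · u₂ + ∫₀¹ w₁ · w₂ dt`, the velocity being `(β_s, ∇_{β_s} q)`. -/
def bundleLength (β : ℝ → E3) (q : ℝ → L2E3) : ℝ :=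
  ∫ s in (0 : ℝ)..1, Real.sqrt (‖velocity β s‖ ^ 2 + ‖covDeriv β q s‖ ^ 2)

/-- `(β, q)` is a geodesic of the bundle: a shortest smooth path between its endpoints. -/
structure IsBundleGeodesic (β : ℝ → E3) (q : ℝ → L2E3) : Prop where
  path : IsBundlePath β q
  shortest : ∀ (γ : ℝ → E3) (r : ℝ → L2E3), IsBundlePath γ r →
    γ 0 = β 0 → r 0 = q 0 → γ 1 = β 1 → r 1 = q 1 →
    bundleLength β q ≤ bundleLength γ r

end

/-! In a parallel frame along its baseline, a bundle path becomes a curve `a` in the fixed Hilbert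
space of the first fibre, and the covariant derivative becomes `a'` (`covDeriv_fibreMap`). The
length is then the integral of `√(|β'|² + |a'|²)`, which is at least `√(ℓ(β)² + ‖a 1 - a 0‖²)`
(`sqrt_le_bundleLength`).

Over a competitor `γ` with the same transport, the straight segment from `a 0` to `a 1`, read in the
parallel frame of `γ`, has the same endpoints in the bundle. Run at speed nearly proportional to
that of `γ`, it has length at most `√((ℓ(γ) + ε)² + ‖a 1 - a 0‖²)` (`exists_bundlePath_le`).
Minimality of the geodesic cancels the fibre term and leaves `ℓ(β) ≤ ℓ(γ) + ε` for every `ε > 0`. -/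

section SkewODE

/-! ### Linear differential equations with skew-symmetric coefficients -/

variable {E : Type*} [NormedAddCommGroup E] [InnerProductSpace ℝ E]

theorem inner_eq_of_skew {B : ℝ → E →L[ℝ] E}
    (hskew : ∀ t ∈ I01, ∀ x y : E, inner ℝ (B t x) y = - inner ℝ x (B t y))
    {V W : ℝ → E} (hV : ∀ t ∈ I01, HasDerivWithinAt V (B t (V t)) I01 t)
    (hW : ∀ t ∈ I01, HasDerivWithinAt W (B t (W t)) I01 t) {s : ℝ} (hs : s ∈ I01) :
    inner ℝ (V s) (W s) = inner ℝ (V 0) (W 0) := by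
  have key : ∀ t ∈ I01, HasDerivWithinAt (fun t => inner ℝ (V t) (W t)) 0 I01 t := by
    intro t ht
    have h := (hV t ht).inner ℝ (hW t ht)
    rwa [hskew t ht, add_neg_cancel] at h
  exact constant_of_derivWithin_zero (fun t ht => (key t ht).differentiableWithinAt)
    (fun t ht => (key t (Ico_subset_Icc_self ht)).derivWithin
      (uniqueDiffOn_Icc_zero_one t (Ico_subset_Icc_self ht))) s hs

/-- The difference of two solutions is a solution, so its norm is constant. -/
theorem eq_of_skew {B : ℝ → E →L[ℝ] E}
    (hskew : ∀ t ∈ I01, ∀ x y : E, inner ℝ (B t x) y = - inner ℝ x (B t y))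
    {V W : ℝ → E} (hV : ∀ t ∈ I01, HasDerivWithinAt V (B t (V t)) I01 t)
    (hW : ∀ t ∈ I01, HasDerivWithinAt W (B t (W t)) I01 t) (h0 : V 0 = W 0) {s : ℝ}
    (hs : s ∈ I01) : V s = W s := by
  have hVW : ∀ t ∈ I01, HasDerivWithinAt (fun t => V t - W t) (B t (V t - W t)) I01 t := by
    intro t ht
    rw [map_sub]
    exact (hV t ht).sub (hW t ht)
  have h := inner_eq_of_skew hskew hVW hVW hs
  rw [h0, sub_self, inner_zero_left, inner_self_eq_zero] at h
  exact sub_eq_zero.mp h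

variable [FiniteDimensional ℝ E]

/-- A cutoff makes the field bounded and globally Lipschitz, so Picard–Lindelöf covers all of
`[0,1]`. The truncated equation is still skew, so its solution keeps norm `‖v‖` and never leaves the
region where the cutoff is `1`. -/
theorem exists_solution_of_skew {B : ℝ → E →L[ℝ] E} (hB : ContinuousOn B I01)
    (hskew : ∀ t ∈ I01, ∀ x y : E, inner ℝ (B t x) y = - inner ℝ x (B t y)) (v : E) :
    ∃ V : ℝ → E, V 0 = v ∧ ∀ t ∈ I01, HasDerivWithinAt V (B t (V t)) I01 t := by
  obtain ⟨C, hC⟩ := isCompact_Icc.exists_bound_of_continuousOn hB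
  have hC0 : 0 ≤ C := (norm_nonneg _).trans (hC 0 (by simp))
  let χ : ContDiffBump (0 : E) := ⟨‖v‖ + 1, ‖v‖ + 2, by positivity, by linarith⟩
  let φ : E → E := fun x => χ x • x
  have hφ : ContDiff ℝ 1 φ := χ.contDiff.smul contDiff_id
  have hsupp : HasCompactSupport φ := χ.hasCompactSupport.smul_right
  obtain ⟨K, hK⟩ := hφ.lipschitzWith_of_hasCompactSupport hsupp one_ne_zero
  obtain ⟨M, hM⟩ := hφ.continuous.bounded_above_of_compact_support hsupp
  have hM0 : 0 ≤ M := (norm_nonneg _).trans (hM 0)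
  -- The speed is at most `C * M` and the time span is `1`, so a ball of radius `C * M` suffices.
  have hPL : IsPicardLindelof (fun t x => B t (φ x)) (tmin := 0) (tmax := 1) ⟨0, by simp⟩ v
      (⟨C * M, by positivity⟩) 0 ⟨C * M, by positivity⟩ (⟨C, hC0⟩ * K) := by
    refine ⟨fun t ht => ?_, fun x _ => ?_, fun t ht x _ => ?_, ?_⟩
    · have h1 : LipschitzWith ⟨C, hC0⟩ (B t) :=
        (B t).lipschitz.weaken (by exact_mod_cast hC t ht)
      exact (h1.comp hK).lipschitzOnWith
    · exact hB.clm_apply continuousOn_const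
    · exact ((B t).le_opNorm _).trans
        (mul_le_mul (hC t ht) (hM x) (norm_nonneg _) hC0)
    · simp
  obtain ⟨V, hV0, hV⟩ := hPL.exists_eq_forall_mem_Icc_hasDerivWithinAt₀
  refine ⟨V, hV0, ?_⟩
  have hnorm : ∀ s ∈ I01, inner ℝ (V s) (V s) = inner ℝ (V 0) (V 0) := by
    refine fun s hs => inner_eq_of_skew (B := fun t => χ (V t) • B t) ?_ ?_ ?_ hs
    · intro t ht x y
      simp [inner_smul_left, inner_smul_right, hskew t ht x y]
    all_goals
      intro t ht
      have h : HasDerivWithinAt V (B t (χ (V t) • V t)) I01 t := hV t ht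
      rw [map_smul] at h
      exact h
  intro t ht
  have hle : ‖V t‖ = ‖v‖ := by
    have h := hnorm t ht
    rw [hV0, real_inner_self_eq_norm_sq, real_inner_self_eq_norm_sq] at h
    exact (sq_eq_sq₀ (norm_nonneg _) (norm_nonneg _)).mp h
  have h1 : χ (V t) = 1 := χ.one_of_mem_closedBall (by
    simp only [Metric.mem_closedBall, dist_zero_right, hle, χ]
    linarith)
  have h := hV t ht
  simpa only [φ, h1, one_smul] using h

theorem exists_fundamental_solution_of_skew {B : ℝ → E →L[ℝ] E} (hB : ContDiffOn ℝ ∞ B I01)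
    (hskew : ∀ t ∈ I01, ∀ x y : E, inner ℝ (B t x) y = - inner ℝ x (B t y)) :
    ∃ R : ℝ → E →L[ℝ] E, ContDiffOn ℝ ∞ R I01 ∧ R 0 = ContinuousLinearMap.id ℝ E ∧
      ∀ t ∈ I01, HasDerivWithinAt R (B t ∘L R t) I01 t := by
  choose V hV0 hV using exists_solution_of_skew hB.continuousOn hskew
  let b := stdOrthonormalBasis ℝ E
  let R : ℝ → E →L[ℝ] E := fun t => ∑ i, (innerSL ℝ (b i)).smulRight (V (b i) t)
  have hR : ∀ t ∈ I01, HasDerivWithinAt R (B t ∘L R t) I01 t := by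
    intro t ht
    have h : HasDerivWithinAt R
        (∑ i, (innerSL ℝ (b i)).smulRight (B t (V (b i) t))) I01 t := by
      refine HasDerivWithinAt.fun_sum fun i _ => ?_
      exact ((ContinuousLinearMap.smulRightL ℝ E E
        (innerSL ℝ (b i))).hasFDerivAt.comp_hasDerivWithinAt t (hV (b i) t ht))
    convert h using 1
    ext x
    simp [R, map_sum]
  refine ⟨R, ?_, ?_, hR⟩
  -- Smoothness bootstraps from the equation, whose right-hand side is smooth in `(t, A)`.
  · refine ODE.contDiffOn_enat_Icc_of_hasDerivWithinAt (n := ⊤) (u := univ)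
      (f := fun t A => B t ∘L A) ?_ hR (mapsTo_univ _ _)
    exact (hB.comp contDiffOn_fst fun p hp => hp.1).clm_comp contDiffOn_snd
  · ext1 x
    simp only [R, sum_apply, ContinuousLinearMap.smulRight_apply, hV0,
      innerSL_apply_apply, ContinuousLinearMap.id_apply]
    exact b.sum_repr' x

end SkewODE

/-! ### Tangent planes, velocities and parallel transport as ambient isometries -/

theorem mem_tangentPlane_iff {x v : E3} : v ∈ tangentPlane x ↔ inner ℝ x v = 0 :=
  Submodule.mem_orthogonal_singleton_iff_inner_right

theorem tangentProj_apply {x : E3} (hx : x ∈ S2) (v : E3) :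
    tangentProj x v = v - (inner ℝ x v : ℝ) • x := by
  have hx1 : ‖x‖ = 1 := by simpa [S2] using hx
  rw [tangentProj, Submodule.starProjection_orthogonal]
  simp [Submodule.starProjection_unit_singleton ℝ hx1]

theorem tangentProj_self {x : E3} (hx : x ∈ S2) : tangentProj x x = 0 := by
  have hx1 : ‖x‖ = 1 := by simpa [S2] using hx
  simp [tangentProj_apply hx, hx1]

theorem tangentProj_of_mem {x v : E3} (hv : v ∈ tangentPlane x) : tangentProj x v = v :=
  Submodule.starProjection_eq_self_iff.mpr hv

theorem velocity_contDiffOn {F : Type*} [NormedAddCommGroup F] [NormedSpace ℝ F] {c : ℝ → F}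
    (hc : ContDiffOn ℝ ∞ c I01) : ContDiffOn ℝ ∞ (velocity c) I01 :=
  hc.derivWithin uniqueDiffOn_Icc_zero_one (by simp)

theorem hasDerivWithinAt_velocity {F : Type*} [NormedAddCommGroup F] [NormedSpace ℝ F] {c : ℝ → F}
    (hc : ContDiffOn ℝ ∞ c I01) {s : ℝ} (hs : s ∈ I01) :
    HasDerivWithinAt c (velocity c s) I01 s :=
  ((hc.differentiableOn (by simp)) s hs).hasDerivWithinAt

theorem velocity_eq {F : Type*} [NormedAddCommGroup F] [NormedSpace ℝ F] {c : ℝ → F} {c' : F}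
    {s : ℝ} (hs : s ∈ I01) (h : HasDerivWithinAt c c' I01 s) : velocity c s = c' :=
  h.derivWithin (uniqueDiffOn_Icc_zero_one s hs)

/-- The infinitesimal generator `V ↦ ⟨β, V⟩ β' - ⟨β', V⟩ β` of parallel transport along a curve `β`
on the sphere, extended to a skew-symmetric operator of the ambient space. -/
noncomputable def transportGen (β : ℝ → E3) (s : ℝ) : E3 →L[ℝ] E3 :=
  (innerSL ℝ (β s)).smulRight (velocity β s) - (innerSL ℝ (velocity β s)).smulRight (β s)

theorem transportGen_apply (β : ℝ → E3) (s : ℝ) (v : E3) : transportGen β s v =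
    (inner ℝ (β s) v : ℝ) • velocity β s - (inner ℝ (velocity β s) v : ℝ) • β s := rfl

theorem transportGen_skew (β : ℝ → E3) (s : ℝ) (x y : E3) :
    inner ℝ (transportGen β s x) y = - inner ℝ x (transportGen β s y) := by
  simp only [transportGen_apply, inner_sub_left, inner_sub_right, real_inner_smul_left,
    real_inner_smul_right, real_inner_comm x]
  ring

theorem transportGen_contDiffOn {β : ℝ → E3} (hβ : ContDiffOn ℝ ∞ β I01) :
    ContDiffOn ℝ ∞ (transportGen β) I01 := by
  have hv := velocity_contDiffOn hβ
  have h1 := (innerSL ℝ (E := E3)).contDiff.comp_contDiffOn hβ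
  have h2 := (innerSL ℝ (E := E3)).contDiff.comp_contDiffOn hv
  exact (h1.smulRight hv).sub (h2.smulRight hβ)

/-- `R` is the family of ambient isometries generated by parallel transport along `β`. -/
structure IsTransport (β : ℝ → E3) (R : ℝ → E3 →L[ℝ] E3) : Prop where
  smooth : ContDiffOn ℝ ∞ R I01
  zero : R 0 = ContinuousLinearMap.id ℝ E3
  hasDeriv : ∀ t ∈ I01, HasDerivWithinAt R (transportGen β t ∘L R t) I01 t

theorem exists_isTransport {β : ℝ → E3} (hβ : ContDiffOn ℝ ∞ β I01) :
    ∃ R, IsTransport β R := by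
  obtain ⟨R, h1, h2, h3⟩ := exists_fundamental_solution_of_skew (transportGen_contDiffOn hβ)
    (fun t _ => transportGen_skew β t)
  exact ⟨R, h1, h2, h3⟩

namespace IsTransport

variable {β : ℝ → E3} {R : ℝ → E3 →L[ℝ] E3}

theorem hasDeriv_apply (hR : IsTransport β R) (v : E3) {t : ℝ} (ht : t ∈ I01) :
    HasDerivWithinAt (fun s => R s v) (transportGen β t (R t v)) I01 t :=
  ((ContinuousLinearMap.apply ℝ E3 v).hasFDerivAt.comp_hasDerivWithinAt t (hR.hasDeriv t ht))

theorem inner_map_map (hR : IsTransport β R) (x y : E3) {s : ℝ} (hs : s ∈ I01) :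
    inner ℝ (R s x) (R s y) = inner ℝ x y := by
  have h := inner_eq_of_skew (fun t _ => transportGen_skew β t)
    (fun t ht => hR.hasDeriv_apply x ht) (fun t ht => hR.hasDeriv_apply y ht) hs
  simpa [hR.zero] using h

theorem norm_map (hR : IsTransport β R) (x : E3) {s : ℝ} (hs : s ∈ I01) : ‖R s x‖ = ‖x‖ := by
  have h := hR.inner_map_map x x hs
  rw [real_inner_self_eq_norm_sq, real_inner_self_eq_norm_sq] at h
  exact (sq_eq_sq₀ (norm_nonneg _) (norm_nonneg _)).mp h

theorem eq_map_of_hasDeriv (hR : IsTransport β R) {V : ℝ → E3}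
    (hV : ∀ t ∈ I01, HasDerivWithinAt V (transportGen β t (V t)) I01 t) {s : ℝ} (hs : s ∈ I01) :
    V s = R s (V 0) :=
  eq_of_skew (fun t _ => transportGen_skew β t) hV (fun t ht => hR.hasDeriv_apply (V 0) ht)
    (by simp [hR.zero]) hs

theorem adjoint_comp (hR : IsTransport β R) {s : ℝ} (hs : s ∈ I01) :
    (R s).adjoint ∘L R s = ContinuousLinearMap.id ℝ E3 := by
  ext1 x
  refine ext_inner_right ℝ fun y => ?_
  simp [ContinuousLinearMap.adjoint_inner_left, hR.inner_map_map x y hs]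

/-- In finite dimension a left inverse is a right inverse. -/
theorem comp_adjoint (hR : IsTransport β R) {s : ℝ} (hs : s ∈ I01) :
    R s ∘L (R s).adjoint = ContinuousLinearMap.id ℝ E3 := by
  have h := hR.adjoint_comp hs
  have h' : ((R s).adjoint : E3 →ₗ[ℝ] E3) ∘ₗ (R s : E3 →ₗ[ℝ] E3) = LinearMap.id := by
    ext1 x
    exact DFunLike.congr_fun h x
  ext1 x
  exact DFunLike.congr_fun ((mul_eq_one_comm (M := Module.End ℝ E3)).mp h') x

end IsTransport

/-! ### Parallel transport along curves on the sphere -/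

section SphereCurve

variable {p₁ p₂ : E3} {β : ℝ → E3} {R : ℝ → E3 →L[ℝ] E3}

theorem IsSphereCurve.inner_self (hβ : IsSphereCurve p₁ p₂ β) {s : ℝ} (hs : s ∈ I01) :
    inner ℝ (β s) (β s) = (1 : ℝ) := by
  have h : ‖β s‖ = 1 := by simpa [S2] using hβ.mem_sphere s hs
  rw [real_inner_self_eq_norm_sq, h, one_pow]

theorem IsSphereCurve.inner_velocity (hβ : IsSphereCurve p₁ p₂ β) {s : ℝ} (hs : s ∈ I01) :
    inner ℝ (β s) (velocity β s) = (0 : ℝ) := by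
  have h := hasDerivWithinAt_velocity hβ.smooth hs
  have h1 := h.inner ℝ h
  have h2 : HasDerivWithinAt (fun t => inner ℝ (β t) (β t)) (0 : ℝ) I01 s :=
    (hasDerivWithinAt_const s I01 (1 : ℝ)).congr (fun t ht => hβ.inner_self ht) (hβ.inner_self hs)
  have h3 := (uniqueDiffOn_Icc_zero_one s hs).eq_deriv _ h1 h2
  rw [real_inner_comm (β s) (velocity β s)] at h3
  linarith

/-- Since `|β|² = 1` and `⟨β, β'⟩ = 0`, the generator sends `β` to `β'`: the position vector itself
solves the transport equation. -/
theorem IsSphereCurve.transport_source (hβ : IsSphereCurve p₁ p₂ β) (hR : IsTransport β R) {s : ℝ}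
    (hs : s ∈ I01) : R s p₁ = β s := by
  rw [← hβ.source]
  refine (hR.eq_map_of_hasDeriv (fun t ht => ?_) hs).symm
  have h := hasDerivWithinAt_velocity hβ.smooth ht
  rwa [transportGen_apply, hβ.inner_self ht, one_smul, real_inner_comm, hβ.inner_velocity ht,
    zero_smul, sub_zero]

theorem IsSphereCurve.inner_transport (hβ : IsSphereCurve p₁ p₂ β) (hR : IsTransport β R) {s : ℝ}
    (hs : s ∈ I01) (v : E3) : inner ℝ (β s) (R s v) = inner ℝ p₁ v := by
  rw [← hβ.transport_source hR hs, hR.inner_map_map _ _ hs]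

theorem IsSphereCurve.transport_mem (hβ : IsSphereCurve p₁ p₂ β) (hR : IsTransport β R) {s : ℝ}
    (hs : s ∈ I01) {v : E3} (hv : v ∈ tangentPlane p₁) : R s v ∈ tangentPlane (β s) := by
  rw [mem_tangentPlane_iff] at hv ⊢
  rwa [hβ.inner_transport hR hs]

theorem IsSphereCurve.isParallelAlong_transport (hβ : IsSphereCurve p₁ p₂ β)
    (hR : IsTransport β R) {v : E3} (hv : v ∈ tangentPlane p₁) :
    IsParallelAlong β (fun s => R s v) where
  smooth := hR.smooth.clm_apply contDiffOn_const
  tangent s hs := hβ.transport_mem hR hs hv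
  parallel s hs := by
    have h := mem_tangentPlane_iff.mp (hβ.transport_mem hR hs hv)
    rw [velocity_eq hs (hR.hasDeriv_apply v hs), transportGen_apply, h, zero_smul, zero_sub,
      map_neg, map_smul, tangentProj_self (hβ.mem_sphere s hs), smul_zero, neg_zero]

/-- Differentiating `⟨β, V⟩ = 0` gives `⟨β, V'⟩ = -⟨β', V⟩`. As `V'` is normal to the sphere, it
must be `-⟨β', V⟩ β`, the generator applied to `V`. -/
theorem IsParallelAlong.eq_transport {V : ℝ → E3} (hV : IsParallelAlong β V)
    (hβ : IsSphereCurve p₁ p₂ β) (hR : IsTransport β R) {s : ℝ} (hs : s ∈ I01) :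
    V s = R s (V 0) := by
  refine hR.eq_map_of_hasDeriv (fun t ht => ?_) hs
  have hd := hasDerivWithinAt_velocity hV.smooth ht
  have hin : ∀ r ∈ I01, inner ℝ (β r) (V r) = (0 : ℝ) := fun r hr =>
    mem_tangentPlane_iff.mp (hV.tangent r hr)
  have h1 := (hasDerivWithinAt_velocity hβ.smooth ht).inner ℝ hd
  have h2 : HasDerivWithinAt (fun r => inner ℝ (β r) (V r)) (0 : ℝ) I01 t :=
    (hasDerivWithinAt_const t I01 (0 : ℝ)).congr hin (hin t ht)
  have h3 := (uniqueDiffOn_Icc_zero_one t ht).eq_deriv _ h1 h2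
  have h4 := hV.parallel t ht
  rw [tangentProj_apply (hβ.mem_sphere t ht), sub_eq_zero] at h4
  have h5 : transportGen β t (V t) = velocity V t := by
    rw [transportGen_apply, hin t ht, zero_smul, zero_sub, ← neg_smul, h4]
    congr 1
    linarith
  rwa [h5]

/-- The parallel transport along `β`, as an isometry between the tangent planes at its endpoints. -/
theorem IsSphereCurve.exists_linearIsometry (hβ : IsSphereCurve p₁ p₂ β) (hR : IsTransport β R) :
    ∃ T : tangentPlane p₁ →ₗᵢ[ℝ] tangentPlane p₂, ∀ v, (T v : E3) = R 1 v := by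
  have h1 : (1 : ℝ) ∈ I01 := by simp
  let f : tangentPlane p₁ →ₗ[ℝ] tangentPlane p₂ :=
    ((R 1 : E3 →ₗ[ℝ] E3).domRestrict (tangentPlane p₁)).codRestrict (tangentPlane p₂)
      (fun v => by simpa [hβ.target] using hβ.transport_mem hR h1 v.2)
  exact ⟨⟨f, fun v => hR.norm_map v h1⟩, fun v => rfl⟩

theorem IsSphereCurve.inducesTransport_iff (hβ : IsSphereCurve p₁ p₂ β) (hR : IsTransport β R)
    (T : tangentPlane p₁ →ₗᵢ[ℝ] tangentPlane p₂) :
    InducesTransport β T ↔ ∀ v, (T v : E3) = R 1 v := by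
  refine ⟨fun h v => ?_, fun h v => ?_⟩
  · obtain ⟨V, hV, h0, h1⟩ := h v
    rw [← h1, ← h0]
    exact hV.eq_transport hβ hR (by simp)
  · exact ⟨_, hβ.isParallelAlong_transport hR v.2, by simp [hR.zero], (h v).symm⟩

/-- The two operators agree on the tangent plane by hypothesis, and on its normal `p₁` because both
send it to `p₂`. -/
theorem IsSphereCurve.transport_eq (hβ : IsSphereCurve p₁ p₂ β) (hR : IsTransport β R)
    {γ : ℝ → E3} {S : ℝ → E3 →L[ℝ] E3} (hγ : IsSphereCurve p₁ p₂ γ) (hS : IsTransport γ S)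
    {T : tangentPlane p₁ →ₗᵢ[ℝ] tangentPlane p₂} (hβT : InducesTransport β T)
    (hγT : InducesTransport γ T) : S 1 = R 1 := by
  have h1 : (1 : ℝ) ∈ I01 := by simp
  rw [hβ.inducesTransport_iff hR] at hβT
  rw [hγ.inducesTransport_iff hS] at hγT
  have hp : inner ℝ p₁ p₁ = (1 : ℝ) := by rw [← hβ.source]; exact hβ.inner_self (by simp)
  ext1 v
  have hw : v - (inner ℝ p₁ v : ℝ) • p₁ ∈ tangentPlane p₁ := by
    rw [mem_tangentPlane_iff, inner_sub_right, real_inner_smul_right, hp, mul_one, sub_self]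
  have h2 := (hγT ⟨_, hw⟩).symm.trans (hβT ⟨_, hw⟩)
  have h3 : S 1 p₁ = R 1 p₁ := by
    rw [hγ.transport_source hS h1, hβ.transport_source hR h1, hγ.target, hβ.target]
  simpa [map_sub, map_smul, h3] using h2

end SphereCurve

/-! ### The fibres and bundle paths in a parallel frame -/

/-- The action of operators of `ℝ³` on `L²([0,1], ℝ³)` by composition. -/
noncomputable def fibreMap : (E3 →L[ℝ] E3) →L[ℝ] L2E3 →L[ℝ] L2E3 :=
  (ContinuousLinearMap.id ℝ (E3 →L[ℝ] E3)).compLpL₂ 2 ((volume : Measure ℝ).restrict I01)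

theorem coeFn_fibreMap (A : E3 →L[ℝ] E3) (z : L2E3) :
    ∀ᵐ t ∂((volume : Measure ℝ).restrict I01), fibreMap A z t = A (z t) :=
  A.coeFn_compLp z

theorem fibreMap_comp (A B : E3 →L[ℝ] E3) (z : L2E3) :
    fibreMap (A ∘L B) z = fibreMap A (fibreMap B z) := by
  ext1
  filter_upwards [coeFn_fibreMap (A ∘L B) z, coeFn_fibreMap A (fibreMap B z), coeFn_fibreMap B z]
    with t h1 h2 h3
  rw [h1, h2, h3, ContinuousLinearMap.comp_apply]

theorem fibreMap_id (z : L2E3) : fibreMap (ContinuousLinearMap.id ℝ E3) z = z := by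
  ext1
  filter_upwards [coeFn_fibreMap (ContinuousLinearMap.id ℝ E3) z] with t h1
  rw [h1, ContinuousLinearMap.id_apply]

theorem norm_fibreMap {A : E3 →L[ℝ] E3} (hA : ∀ v, ‖A v‖ = ‖v‖) (z : L2E3) :
    ‖fibreMap A z‖ = ‖z‖ := by
  apply le_antisymm <;>
  · apply Lp.norm_le_norm_of_ae_le
    filter_upwards [coeFn_fibreMap A z] with t h
    rw [h, hA]

/-- The fibre `L²([0,1], T_x(𝕊²))` of the bundle. -/
noncomputable def tangentFibre (x : E3) : Submodule ℝ L2E3 :=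
  LinearMap.ker ((innerSL ℝ x).compLpL 2 ((volume : Measure ℝ).restrict I01)).toLinearMap

theorem mem_tangentFibre_iff {x : E3} {z : L2E3} : z ∈ tangentFibre x ↔
    ∀ᵐ t ∂((volume : Measure ℝ).restrict I01), z t ∈ tangentPlane x := by
  have h := (innerSL ℝ x).coeFn_compLpL (p := 2) (μ := (volume : Measure ℝ).restrict I01) z
  rw [tangentFibre, LinearMap.mem_ker]
  change (innerSL ℝ x).compLpL 2 ((volume : Measure ℝ).restrict I01) z = 0 ↔ _
  rw [Lp.eq_zero_iff_ae_eq_zero]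
  refine Filter.eventually_congr ?_
  filter_upwards [h] with t ht
  rw [mem_tangentPlane_iff, ht]
  rfl

/-- The fibre is the kernel of a continuous linear map, which commutes with differentiation. -/
theorem velocity_mem_tangentFibre {x : E3} {a : ℝ → L2E3} (ha : ContDiffOn ℝ ∞ a I01)
    (hmem : ∀ s ∈ I01, a s ∈ tangentFibre x) {s : ℝ} (hs : s ∈ I01) :
    velocity a s ∈ tangentFibre x := by
  have h1 := ((innerSL ℝ x).compLpL 2
    ((volume : Measure ℝ).restrict I01)).hasFDerivAt.comp_hasDerivWithinAt s
    (hasDerivWithinAt_velocity ha hs)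
  have h2 := (hasDerivWithinAt_const s I01
    (0 : Lp ℝ 2 ((volume : Measure ℝ).restrict I01))).congr (fun t ht => hmem t ht) (hmem s hs)
  exact (uniqueDiffOn_Icc_zero_one s hs).eq_deriv _ h1 h2

theorem fibreMap_congr {x : E3} {A B : E3 →L[ℝ] E3} (h : ∀ v ∈ tangentPlane x, A v = B v)
    {z : L2E3} (hz : z ∈ tangentFibre x) : fibreMap A z = fibreMap B z := by
  ext1
  filter_upwards [coeFn_fibreMap A z, coeFn_fibreMap B z, mem_tangentFibre_iff.mp hz] with t h1 h2 h3
  rw [h1, h2, h _ h3]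

theorem fibreMap_mem_tangentFibre {x y : E3} {A : E3 →L[ℝ] E3}
    (h : ∀ v ∈ tangentPlane x, A v ∈ tangentPlane y) {z : L2E3} (hz : z ∈ tangentFibre x) :
    fibreMap A z ∈ tangentFibre y := by
  rw [mem_tangentFibre_iff] at hz ⊢
  filter_upwards [coeFn_fibreMap A z, hz] with t h1 h2
  rw [h1]
  exact h _ h2

section

variable {p₁ p₂ : E3} {β : ℝ → E3} {R : ℝ → E3 →L[ℝ] E3} {a : ℝ → L2E3}

theorem IsTransport.contDiffOn_fibreMap (hR : IsTransport β R) (ha : ContDiffOn ℝ ∞ a I01) :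
    ContDiffOn ℝ ∞ (fun s => fibreMap (R s) (a s)) I01 :=
  (fibreMap.contDiff.comp_contDiffOn hR.smooth).clm_apply ha

/-- Covariant differentiation is ordinary differentiation in a parallel frame. -/
theorem IsSphereCurve.covDeriv_fibreMap (hβ : IsSphereCurve p₁ p₂ β) (hR : IsTransport β R)
    (ha : ContDiffOn ℝ ∞ a I01) (hmem : ∀ s ∈ I01, a s ∈ tangentFibre p₁) {s : ℝ} (hs : s ∈ I01) :
    covDeriv β (fun s => fibreMap (R s) (a s)) s = fibreMap (R s) (velocity a s) := by
  have hd := (fibreMap.hasFDerivAt.comp_hasDerivWithinAt s (hR.hasDeriv s hs)).clm_apply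
    (hasDerivWithinAt_velocity ha hs)
  have hv : velocity (fun s => fibreMap (R s) (a s)) s =
      fibreMap (transportGen β s ∘L R s) (a s) + fibreMap (R s) (velocity a s) :=
    velocity_eq hs hd
  change fibreMap (tangentProj (β s)) (velocity (fun s => fibreMap (R s) (a s)) s) = _
  -- In the product rule, the generator sends tangent vectors to multiples of `β s`, which the
  -- projection kills; the other term is already tangent.
  rw [hv, map_add, ← fibreMap_comp, ← fibreMap_comp,
    fibreMap_congr (B := 0) _ (hmem s hs),
    fibreMap_congr (B := R s) _ (velocity_mem_tangentFibre ha hmem hs)]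
  · simp
  · exact fun v hv => tangentProj_of_mem (hβ.transport_mem hR hs hv)
  · intro v hv
    have h := mem_tangentPlane_iff.mp (hβ.transport_mem hR hs hv)
    simp [transportGen_apply, h, tangentProj_self (hβ.mem_sphere s hs)]

theorem IsSphereCurve.norm_covDeriv_fibreMap (hβ : IsSphereCurve p₁ p₂ β) (hR : IsTransport β R)
    (ha : ContDiffOn ℝ ∞ a I01) (hmem : ∀ s ∈ I01, a s ∈ tangentFibre p₁) {s : ℝ} (hs : s ∈ I01) :
    ‖covDeriv β (fun s => fibreMap (R s) (a s)) s‖ = ‖velocity a s‖ := by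
  rw [hβ.covDeriv_fibreMap hR ha hmem hs, norm_fibreMap fun v => hR.norm_map v hs]

theorem IsSphereCurve.isBundlePath_fibreMap (hβ : IsSphereCurve p₁ p₂ β) (hR : IsTransport β R)
    (ha : ContDiffOn ℝ ∞ a I01) (hmem : ∀ s ∈ I01, a s ∈ tangentFibre p₁) :
    IsBundlePath β (fun s => fibreMap (R s) (a s)) where
  smooth_base := hβ.smooth
  smooth_fibre := hR.contDiffOn_fibreMap ha
  mem_bundle s hs := ⟨hβ.mem_sphere s hs, mem_tangentFibre_iff.mp
    (fibreMap_mem_tangentFibre (fun _ hv => hβ.transport_mem hR hs hv) (hmem s hs))⟩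

theorem bundleLength_congr {q r : ℝ → L2E3} (h : ∀ s ∈ I01, q s = r s) :
    bundleLength β q = bundleLength β r := by
  refine intervalIntegral.integral_congr fun s hs => ?_
  rw [uIcc_of_le zero_le_one] at hs
  have hv : velocity q s = velocity r s := derivWithin_congr h (h s hs)
  simp only [covDeriv, hv]

theorem IsSphereCurve.bundleLength_fibreMap (hβ : IsSphereCurve p₁ p₂ β) (hR : IsTransport β R)
    (ha : ContDiffOn ℝ ∞ a I01) (hmem : ∀ s ∈ I01, a s ∈ tangentFibre p₁) :
    bundleLength β (fun s => fibreMap (R s) (a s)) =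
      ∫ s in (0 : ℝ)..1, Real.sqrt (‖velocity β s‖ ^ 2 + ‖velocity a s‖ ^ 2) := by
  refine intervalIntegral.integral_congr fun s hs => ?_
  rw [uIcc_of_le zero_le_one] at hs
  simp only [hβ.norm_covDeriv_fibreMap hR ha hmem hs]

/-- Every path in the bundle can be written in a parallel frame along its baseline. -/
theorem IsBundlePath.exists_parallel_coordinates {q : ℝ → L2E3} (hq : IsBundlePath β q)
    (hβ : IsSphereCurve p₁ p₂ β) (hR : IsTransport β R) :
    ∃ a : ℝ → L2E3, ContDiffOn ℝ ∞ a I01 ∧ (∀ s ∈ I01, a s ∈ tangentFibre p₁) ∧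
      ∀ s ∈ I01, q s = fibreMap (R s) (a s) := by
  refine ⟨fun s => fibreMap (R s).adjoint (q s), ?_, fun s hs => ?_, fun s hs => ?_⟩
  · have h : ContDiffOn ℝ ∞ (fun s => (R s).adjoint) I01 :=
      ((ContinuousLinearMap.adjoint (𝕜 := ℝ) (E := E3) (F := E3)).toContinuousLinearEquiv.contDiff
        (𝕜 := ℝ)).comp_contDiffOn hR.smooth
    exact (fibreMap.contDiff.comp_contDiffOn h).clm_apply hq.smooth_fibre
  · refine fibreMap_mem_tangentFibre (fun v hv => ?_)
      (mem_tangentFibre_iff.mpr (hq.mem_bundle s hs).2)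
    rw [mem_tangentPlane_iff] at hv ⊢
    rwa [ContinuousLinearMap.adjoint_inner_right, hβ.transport_source hR hs]
  · rw [← fibreMap_comp, hR.comp_adjoint hs, fibreMap_id]

end

/-! ### Integral inequalities and reparametrization -/

theorem ContinuousOn.intervalIntegrable_I01 {F : Type*} [NormedAddCommGroup F] {f : ℝ → F}
    (hf : ContinuousOn f I01) : IntervalIntegrable f volume 0 1 :=
  ContinuousOn.intervalIntegrable (by rwa [uIcc_of_le zero_le_one])

theorem norm_sub_le_integral_velocity {F : Type*} [NormedAddCommGroup F] [NormedSpace ℝ F]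
    [CompleteSpace F] {a : ℝ → F} (ha : ContDiffOn ℝ ∞ a I01) :
    ‖a 1 - a 0‖ ≤ ∫ s in (0 : ℝ)..1, ‖velocity a s‖ := by
  have h := intervalIntegral.integral_eq_sub_of_hasDerivAt_of_le zero_le_one ha.continuousOn
    (fun s hs => (hasDerivWithinAt_velocity ha (Ioo_subset_Icc_self hs)).hasDerivAt
      (Icc_mem_nhds hs.1 hs.2)) (velocity_contDiffOn ha).continuousOn.intervalIntegrable_I01
  rw [← h]
  exact intervalIntegral.norm_integral_le_integral_norm zero_le_one

/-- This is the bound of the norm of an integral by the integral of the norm, for the plane vector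
`(u, w)`: pair it with its integral `(I, J)`, apply Cauchy–Schwarz and divide by `S`. -/
theorem sqrt_sq_integral_add_sq_le {u w : ℝ → ℝ} (hu : ContinuousOn u I01)
    (hw : ContinuousOn w I01) :
    Real.sqrt ((∫ s in (0 : ℝ)..1, u s) ^ 2 + (∫ s in (0 : ℝ)..1, w s) ^ 2) ≤
      ∫ s in (0 : ℝ)..1, Real.sqrt (u s ^ 2 + w s ^ 2) := by
  set I := ∫ s in (0 : ℝ)..1, u s
  set J := ∫ s in (0 : ℝ)..1, w s
  set S := Real.sqrt (I ^ 2 + J ^ 2)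
  have hS : S ^ 2 = I ^ 2 + J ^ 2 := Real.sq_sqrt (by positivity)
  have hint : ContinuousOn (fun s => Real.sqrt (u s ^ 2 + w s ^ 2)) I01 :=
    ((hu.pow 2).add (hw.pow 2)).sqrt
  have h1 : ∫ s in (0 : ℝ)..1, (I * u s + J * w s) = S * S := by
    rw [intervalIntegral.integral_add, intervalIntegral.integral_const_mul,
      intervalIntegral.integral_const_mul]
    · linear_combination -hS
    · exact (hu.const_mul I).intervalIntegrable_I01
    · exact (hw.const_mul J).intervalIntegrable_I01
  have h2 : ∫ s in (0 : ℝ)..1, (I * u s + J * w s) ≤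
      ∫ s in (0 : ℝ)..1, S * Real.sqrt (u s ^ 2 + w s ^ 2) := by
    refine intervalIntegral.integral_mono_on zero_le_one
      ((hu.const_mul I).add (hw.const_mul J)).intervalIntegrable_I01
      (hint.const_mul S).intervalIntegrable_I01 fun s _ => ?_
    rw [← Real.sqrt_mul (by positivity)]
    refine Real.le_sqrt_of_sq_le ?_
    nlinarith [sq_nonneg (I * w s - J * u s)]
  rw [h1, intervalIntegral.integral_const_mul] at h2
  rcases (Real.sqrt_nonneg (I ^ 2 + J ^ 2)).eq_or_lt with h0 | h0
  · change 0 = S at h0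
    rw [← h0]
    exact intervalIntegral.integral_nonneg zero_le_one fun s _ => Real.sqrt_nonneg _
  · exact le_of_mul_le_mul_left h2 h0

theorem exists_reparametrization {g : ℝ → ℝ} (hg : ContDiffOn ℝ ∞ g I01)
    (hpos : 0 < ∫ s in (0 : ℝ)..1, g s) :
    ∃ f : ℝ → ℝ, ContDiffOn ℝ ∞ f I01 ∧ f 0 = 0 ∧ f 1 = 1 ∧
      ∀ s ∈ I01, velocity f s = g s / ∫ t in (0 : ℝ)..1, g t := by
  set L := ∫ s in (0 : ℝ)..1, g s
  have hd : ∀ s ∈ I01, HasDerivWithinAt (fun s => (∫ t in (0 : ℝ)..s, g t) / L) (g s / L) I01 s := by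
    intro s hs
    have : Fact (s ∈ Icc (0 : ℝ) 1) := ⟨hs⟩
    refine HasDerivWithinAt.div_const (intervalIntegral.integral_hasDerivWithinAt_right ?_
      (hg.continuousOn.stronglyMeasurableAtFilter_nhdsWithin measurableSet_Icc s)
      (hg.continuousOn s hs)) L
    refine ContinuousOn.intervalIntegrable (hg.continuousOn.mono ?_)
    rw [uIcc_of_le hs.1]
    exact Icc_subset_Icc_right hs.2
  refine ⟨fun s => (∫ t in (0 : ℝ)..s, g t) / L, ?_, by simp, div_self hpos.ne', fun s hs => velocity_eq hs (hd s hs)⟩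
  -- The primitive solves an equation whose right-hand side ignores the state.
  refine ODE.contDiffOn_enat_Icc_of_hasDerivWithinAt (n := ⊤) (u := univ)
    (f := fun t _ => g t / L) ?_ hd (mapsTo_univ _ _)
  exact (hg.comp contDiffOn_fst fun p hp => hp.1).div_const L

/-! ### Length bounds in the bundle and the conclusion -/

section

variable {p₁ p₂ : E3} {β : ℝ → E3} {R : ℝ → E3 →L[ℝ] E3}

theorem IsSphereCurve.sqrt_le_bundleLength (hβ : IsSphereCurve p₁ p₂ β) (hR : IsTransport β R)
    {a : ℝ → L2E3} (ha : ContDiffOn ℝ ∞ a I01) (hmem : ∀ s ∈ I01, a s ∈ tangentFibre p₁) :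
    Real.sqrt (curveLength β ^ 2 + ‖a 1 - a 0‖ ^ 2) ≤
      bundleLength β (fun s => fibreMap (R s) (a s)) := by
  rw [hβ.bundleLength_fibreMap hR ha hmem]
  refine le_trans (Real.sqrt_le_sqrt ?_) (sqrt_sq_integral_add_sq_le
    (velocity_contDiffOn hβ.smooth).continuousOn.norm (velocity_contDiffOn ha).continuousOn.norm)
  refine add_le_add (le_refl _) (pow_le_pow_left₀ (norm_nonneg _) ?_ 2)
  exact norm_sub_le_integral_velocity ha

theorem IsSphereCurve.exists_bundlePath_le (hβ : IsSphereCurve p₁ p₂ β) (hR : IsTransport β R)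
    {b c : L2E3} (hb : b ∈ tangentFibre p₁) (hc : c ∈ tangentFibre p₁) {ε : ℝ} (hε : 0 < ε) :
    ∃ r : ℝ → L2E3, IsBundlePath β r ∧ r 0 = b ∧ r 1 = fibreMap (R 1) c ∧
      bundleLength β r ≤ Real.sqrt ((curveLength β + ε) ^ 2 + ‖c - b‖ ^ 2) := by
  have hv := velocity_contDiffOn hβ.smooth
  -- The `ε` keeps the speed smooth and positive even where `β'` vanishes; its integral exceeds the
  -- length of `β` by at most `ε`.
  set g : ℝ → ℝ := fun s => Real.sqrt (‖velocity β s‖ ^ 2 + ε ^ 2) with hgdef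
  have hg : ContDiffOn ℝ ∞ g I01 :=
    ((hv.norm_sq ℝ).add contDiffOn_const).sqrt fun s _ => by positivity
  have hgint := hg.continuousOn.intervalIntegrable_I01
  have hpos : 0 < ∫ s in (0 : ℝ)..1, g s :=
    intervalIntegral.intervalIntegral_pos_of_pos hgint
      (fun s => Real.sqrt_pos.mpr (by positivity)) zero_lt_one
  have hL : ∫ s in (0 : ℝ)..1, g s ≤ curveLength β + ε := by
    have h : ∫ s in (0 : ℝ)..1, (‖velocity β s‖ + ε) = curveLength β + ε := by
      rw [intervalIntegral.integral_add hv.continuousOn.norm.intervalIntegrable_I01 (by simp)]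
      simp [curveLength]
    rw [← h]
    refine intervalIntegral.integral_mono_on zero_le_one hgint
      (hv.continuousOn.norm.add continuousOn_const).intervalIntegrable_I01 fun s _ => ?_
    refine Real.sqrt_le_iff.mpr ⟨by positivity, ?_⟩
    nlinarith [norm_nonneg (velocity β s)]
  obtain ⟨f, hf, hf0, hf1, hfv⟩ := exists_reparametrization hg hpos
  set L := ∫ s in (0 : ℝ)..1, g s
  set a : ℝ → L2E3 := fun s => b + f s • (c - b) with hadef
  have ha : ContDiffOn ℝ ∞ a I01 := contDiffOn_const.add (hf.smul contDiffOn_const)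
  have hmem : ∀ s ∈ I01, a s ∈ tangentFibre p₁ := fun s _ =>
    add_mem hb (Submodule.smul_mem _ _ (sub_mem hc hb))
  have hav : ∀ s ∈ I01, velocity a s = (g s / L) • (c - b) := by
    intro s hs
    rw [← hfv s hs]
    exact velocity_eq hs (((hasDerivWithinAt_velocity hf hs).smul_const (c - b)).const_add b)
  refine ⟨fun s => fibreMap (R s) (a s), hβ.isBundlePath_fibreMap hR ha hmem, ?_, ?_, ?_⟩
  · simp [hadef, hf0, hR.zero, fibreMap_id]
  · simp [hadef, hf1]
  · rw [hβ.bundleLength_fibreMap hR ha hmem]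
    set D := ‖c - b‖
    -- Because `|β'| ≤ g` and `|a'| = g D / L`, the integrand is at most `g` times a constant, and
    -- the bound integrates to `√(L² + D²)`.
    have hle : ∫ s in (0 : ℝ)..1, Real.sqrt (‖velocity β s‖ ^ 2 + ‖velocity a s‖ ^ 2) ≤
        ∫ s in (0 : ℝ)..1, g s * Real.sqrt (1 + (D / L) ^ 2) := by
      refine intervalIntegral.integral_mono_on zero_le_one
        ((hv.continuousOn.norm.pow 2).add
          ((velocity_contDiffOn ha).continuousOn.norm.pow 2)).sqrt.intervalIntegrable_I01
        (hg.continuousOn.mul continuousOn_const).intervalIntegrable_I01 fun s hs => ?_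
      rw [hav s hs, norm_smul, mul_pow, Real.norm_eq_abs, sq_abs, hgdef,
        ← Real.sqrt_mul (by positivity)]
      refine Real.sqrt_le_sqrt ?_
      have hg2 : g s ^ 2 = ‖velocity β s‖ ^ 2 + ε ^ 2 := Real.sq_sqrt (by positivity)
      have : (g s / L) ^ 2 * D ^ 2 = (‖velocity β s‖ ^ 2 + ε ^ 2) * (D / L) ^ 2 := by
        rw [← hg2]
        ring
      change _ + (g s / L) ^ 2 * D ^ 2 ≤ _
      rw [this]
      nlinarith [sq_nonneg ε]
    refine hle.trans ?_
    rw [intervalIntegral.integral_mul_const]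
    change L * _ ≤ _
    have : L * Real.sqrt (1 + (D / L) ^ 2) = Real.sqrt (L ^ 2 + D ^ 2) := by
      rw [← Real.sqrt_sq hpos.le, ← Real.sqrt_mul (by positivity), Real.sqrt_sq hpos.le]
      congr 1
      field_simp
    rw [this]
    gcongr

end

theorem curveLength_nonneg (β : ℝ → E3) : 0 ≤ curveLength β :=
  intervalIntegral.integral_nonneg zero_le_one fun _ _ => norm_nonneg _

theorem lemma1 (β : ℝ → E3) (q : ℝ → L2E3) (h : IsBundleGeodesic β q) : IsPOptimal β := by
  have h0 : (0 : ℝ) ∈ I01 := by simp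
  have h1 : (1 : ℝ) ∈ I01 := by simp
  have hβ : IsSphereCurve (β 0) (β 1) β :=
    ⟨h.path.smooth_base, fun s hs => (h.path.mem_bundle s hs).1, rfl, rfl⟩
  obtain ⟨R, hR⟩ := exists_isTransport hβ.smooth
  obtain ⟨T, hT⟩ := hβ.exists_linearIsometry hR
  have hβT : InducesTransport β T := (hβ.inducesTransport_iff hR T).mpr hT
  refine ⟨T, hβ, hβT, fun γ hγ hγT => ?_⟩
  obtain ⟨S, hS⟩ := exists_isTransport hγ.smooth
  obtain ⟨a, ha, hmem, hq⟩ := h.path.exists_parallel_coordinates hβ hR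
  refine le_of_forall_pos_le_add fun ε hε => ?_
  obtain ⟨r, hr, hr0, hr1, hrl⟩ := hγ.exists_bundlePath_le hS (hmem 0 h0) (hmem 1 h1) hε
  -- Equal transport, `S 1 = R 1`, is what makes the competitor end at `q 1`.
  have hle := h.shortest γ r hr hγ.source (by rw [hr0, hq 0 h0, hR.zero, fibreMap_id]) hγ.target
    (by rw [hr1, hq 1 h1, hβ.transport_eq hR hγ hS hβT hγT])
  rw [bundleLength_congr hq] at hle
  have h2 := ((hβ.sqrt_le_bundleLength hR ha hmem).trans hle).trans hrl
  rw [Real.sqrt_le_sqrt_iff (by positivity), add_le_add_iff_right] at h2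
  exact le_of_sq_le_sq h2 (add_nonneg (curveLength_nonneg γ) hε.le)
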